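/- Theorem. Let $a,b\in\mathbb R$ and let $K:[0,\infty)\to[0,\infty)$ be piecewise continuous (finitely many discontinuities in each bounded interval, finite one-sided limits) with $\int_0^\infty K(s)\,ds=1$ and $\int_0^\infty e^{\mu s}K(s)\,ds<\infty$ for some fixed $\mu>0$. Consider the delay equation $$x'(t)=a\,x(t)+b\int_0^\infty K(s)\,x(t-s)\,ds,\qquad t\ge 0,\tag{1}$$ with bounded continuous initial functions $\varphi:(-\infty,0]\to\mathbb R$, $\|\varphi\|=\sup_{\theta\le 0}|\varphi(\theta)|$; let $x_\varphi$ denote the solution of (1) with $x_\varphi=\varphi$ on $(-\infty,0]$ (the derivative at $t=0$ being the right derivative). Let $$h(\lambda)=\lambda-a-b\int_0^\infty e^{-\lambda s}K(s)\,ds,\qquad \alpha_0=\sup\{\operatorname{Re}\lambda: h(\lambda)=0\}\in[-\infty,\infty],$$ where $\lambda$ ranges over the complex numbers for which the integral converges absolutely (these include all $\lambda$ with $\operatorname{Re}\lambda\ge-\mu$) and $\sup\emptyset=-\infty$. (i) For every real $\alpha>\max\{\alpha_0,-\mu\}$ there is a constant $K_1>0$, depending on $\alpha$, $\mu$ and the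 equation ($a,b,K$) but not on $\varphi$ or $t$, such that for every initial function $\varphi$ $$|x_\varphi(t)|\le K_1\|\varphi\|e^{\alpha t},\qquad t\ge 0.$$ (ii) The trivial solution of (1) is locally asymptotically stable if and only if $\alpha_0<0$. Here locally asymptotically stable means: for every $\varepsilon>0$ there is $\delta>0$ such that $\|\varphi\|<\delta$ implies $|x_\varphi(t)|<\varepsilon$ for all $t\ge 0$; and there is $\delta>0$ such that $\|\varphi\|<\delta$ implies $x_\varphi(t)\to 0$ as $t\to\infty$. -/

import Mathlib

open Set Filter Topology MeasureTheory BoundedContinuousFunction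

/-- A function is piecewise continuous on `[0, ∞)`: it has only finitely many discontinuities in
each bounded interval `[0, T]`, and it has finite one-sided limits at every point.  The values
on `(-∞, 0)` play no role. -/
def PiecewiseContinuousOnHalfLine (f : ℝ → ℝ) : Prop :=
  (∀ T : ℝ, {t ∈ Icc (0 : ℝ) T | ¬ ContinuousWithinAt f (Ici 0) t}.Finite) ∧
  (∀ t : ℝ, 0 ≤ t → ∃ l : ℝ, Tendsto f (𝓝[>] t) (𝓝 l)) ∧
  (∀ t : ℝ, 0 < t → ∃ l : ℝ, Tendsto f (𝓝[<] t) (𝓝 l))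

/-- The integrand `e^{-λ s} f(s)` of the Laplace transform. -/
noncomputable def laplaceIntegrand (f : ℝ → ℝ) (lam : ℂ) (s : ℝ) : ℂ :=
  Complex.exp (-lam * (s : ℂ)) * (f s : ℂ)

/-- The Laplace transform `∫₀^∞ e^{-λ s} f(s) ds`; meaningful where the integrand is integrable. -/
noncomputable def laplaceTransform (f : ℝ → ℝ) (lam : ℂ) : ℂ :=
  ∫ s in Ioi (0 : ℝ), laplaceIntegrand f lam s

/-- The characteristic function `h(λ) = λ - a - b ℒ(K)(λ)`. -/
noncomputable def charFunction (a b : ℝ) (K : ℝ → ℝ) (lam : ℂ) : ℂ :=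
  lam - (a : ℂ) - (b : ℂ) * laplaceTransform K lam

/-- The roots of the characteristic function, in the domain where its Laplace integral
converges (absolutely). -/
def charRoots (a b : ℝ) (K : ℝ → ℝ) : Set ℂ :=
  {lam : ℂ | IntegrableOn (laplaceIntegrand K lam) (Ioi (0 : ℝ)) ∧ charFunction a b K lam = 0}

/-- `α₀ = sup {Re λ : h(λ) = 0}`, an extended real number: it is `-∞` if there are no roots. -/
noncomputable def alphaZero (a b : ℝ) (K : ℝ → ℝ) : EReal :=
  sSup ((fun lam : ℂ => ((lam.re : ℝ) : EReal)) '' charRoots a b K)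

/-- `x` is a solution of `x'(t) = a x(t) + b ∫₀^∞ K(s) x(t - s) ds`, `t ≥ 0`, with the bounded
continuous initial function `φ` on `(-∞, 0]`.  The derivative is two-sided for `t > 0` and is
the right derivative at `t = 0`. -/
def IsDelaySolution (a b : ℝ) (K : ℝ → ℝ) (φ : Iic (0 : ℝ) →ᵇ ℝ) (x : ℝ → ℝ) : Prop :=
  (∀ θ : Iic (0 : ℝ), x θ = φ θ) ∧
  ∀ t : ℝ, 0 ≤ t →
    HasDerivWithinAt x (a * x t + b * ∫ s in Ioi (0 : ℝ), K s * x (t - s)) (Ici 0) t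

/-- Lyapunov stability of the trivial solution. -/
def TrivialSolutionStable (a b : ℝ) (K : ℝ → ℝ) : Prop :=
  ∀ ε : ℝ, 0 < ε → ∃ δ : ℝ, 0 < δ ∧
    ∀ (φ : Iic (0 : ℝ) →ᵇ ℝ) (x : ℝ → ℝ), IsDelaySolution a b K φ x → ‖φ‖ < δ →
      ∀ t : ℝ, 0 ≤ t → |x t| < ε

/-- Local attractivity of the trivial solution. -/
def TrivialSolutionLocallyAttractive (a b : ℝ) (K : ℝ → ℝ) : Prop :=
  ∃ δ : ℝ, 0 < δ ∧
    ∀ (φ : Iic (0 : ℝ) →ᵇ ℝ) (x : ℝ → ℝ), IsDelaySolution a b K φ x → ‖φ‖ < δ →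
      Tendsto x atTop (𝓝 0)

/-- Local asymptotic stability of the trivial solution: stable and locally attractive. -/
def TrivialSolutionLocallyAsymptoticallyStable (a b : ℝ) (K : ℝ → ℝ) : Prop :=
  TrivialSolutionStable a b K ∧ TrivialSolutionLocallyAttractive a b K

/-! For (i), extend `φ` to the line by `φ(0) e^{-μt}` and subtract this extension from the solution.
The difference `z` is continuous and vanishes on `(-∞, 0]`. It solves the same equation with a
forcing `g` of size `O(‖φ‖ e^{-μt})`; the exponential moment of `K` gives this decay. Extending by
zero would leave a jump at `0` and a transform that need not be integrable on vertical lines;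
extending by the constant `φ(0)` would leave a forcing that need not decay.

An a priori growth bound makes the Laplace transform of `z` converge far to the right, where `h ẑ =
ĝ`. Since `h(λ) = λ + O(1)` has no zeros on `Re λ ≥ α`, it satisfies `|h| ≥ c (1 + |Im λ|)` on every
strip `α ≤ Re λ ≤ γ`. Hence `1/h` is square integrable on vertical lines, and so is `ĝ` by
Plancherel; their product is integrable and Fourier inversion recovers `z`. Cauchy's theorem moves
the inversion integral to `Re λ = α`, and Cauchy–Schwarz there gives `|z(t)| ≤ C ‖φ‖ e^{αt}`
(`abs_le_of_laplaceTransform_eq`).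

For (ii), if `α₀ < 0`, some `α < 0` is admissible in (i). Conversely, the zeros with `Re λ ≥ -μ/2`
form a compact set, so `α₀ ≥ 0` is witnessed by a zero with `Re λ ≥ 0`. Small multiples of `Re
e^{λt}` are then solutions with small bounded history that do not tend to `0`. -/

open scoped FourierTransform SchwartzMap ContDiff

/-! ### Plancherel on `L¹ ∩ L²` -/

/-- On `L¹ ∩ L²`, the `L²` Fourier transform is given by the Fourier integral. -/
theorem fourier_toLp_ae_eq {f : ℝ → ℂ} (hf : Integrable f) (hf2 : MemLp f 2) :
    (𝓕 (hf2.toLp f) : Lp ℂ 2 (volume : Measure ℝ)) =ᵐ[volume] 𝓕 f := by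
  have hcont : Continuous (𝓕 f) :=
    VectorFourier.fourierIntegral_continuous Real.continuous_fourierChar
      (by exact continuous_inner) hf
  -- Both sides are tested against smooth compactly supported functions. The transform moves onto
  -- the test function by its distributional definition, then back onto `f` by Fubini.
  refine ae_eq_of_integral_contDiff_smul_eq
    ((Lp.memLp (𝓕 (hf2.toLp f))).locallyIntegrable (by norm_num)) hcont.locallyIntegrable ?_
  intro g g_smooth g_cpt
  have hg₁ : HasCompactSupport (Complex.ofRealCLM ∘ g) := g_cpt.comp_left rfl
  have hg₂ : ContDiff ℝ ∞ (Complex.ofRealCLM ∘ g) := by fun_prop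
  set gS : 𝓢(ℝ, ℂ) := hg₁.toSchwartzMap hg₂ with hgS
  have hgv : ∀ x, gS x = (g x : ℂ) := fun x => rfl
  calc
    ∫ x, g x • (𝓕 (hf2.toLp f) : Lp ℂ 2 (volume : Measure ℝ)) x
        = Lp.toTemperedDistribution (𝓕 (hf2.toLp f)) gS := by
          rw [Lp.toTemperedDistribution_apply]; simp [hgv]
    _ = Lp.toTemperedDistribution (hf2.toLp f) (𝓕 gS) := by
          rw [← Lp.fourier_toTemperedDistribution_eq, TemperedDistribution.fourier_apply]
    _ = ∫ x, (𝓕 gS) x • f x := by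
          rw [Lp.toTemperedDistribution_apply]
          refine integral_congr_ae ?_
          filter_upwards [hf2.coeFn_toLp] with x hx
          rw [hx]
    _ = ∫ x, gS x • 𝓕 f x := by
          simpa using! VectorFourier.integral_fourierIntegral_smul_eq_flip (L := innerₗ ℝ)
            Real.continuous_fourierChar continuous_inner gS.integrable hf
    _ = ∫ x, g x • 𝓕 f x := by simp [hgv]

/-- **Plancherel's theorem** for the Fourier integral on `L¹ ∩ L²`. -/
theorem eLpNorm_fourier_eq {f : ℝ → ℂ} (hf : Integrable f) (hf2 : MemLp f 2) :
    eLpNorm (𝓕 f) 2 volume = eLpNorm f 2 volume := by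
  have h := Lp.norm_fourier_eq (hf2.toLp f)
  rw [Lp.norm_toLp, Lp.norm_def, eLpNorm_congr_ae (fourier_toLp_ae_eq hf hf2)] at h
  have h1 : eLpNorm (𝓕 f) 2 volume ≠ ⊤ := by
    rw [← eLpNorm_congr_ae (fourier_toLp_ae_eq hf hf2)]
    exact (Lp.memLp _).2.ne
  exact (ENNReal.toReal_eq_toReal_iff' h1 hf2.2.ne).1 h

theorem memLp_two_fourier {f : ℝ → ℂ} (hf : Integrable f) (hf2 : MemLp f 2) :
    MemLp (𝓕 f) 2 :=
  (Lp.memLp (𝓕 (hf2.toLp f) : Lp ℂ 2 (volume : Measure ℝ))).ae_eq (fourier_toLp_ae_eq hf hf2)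

/-! ### Laplace transforms: convergence, holomorphy, convolution -/

theorem norm_laplaceIntegrand (f : ℝ → ℝ) (lam : ℂ) (s : ℝ) :
    ‖laplaceIntegrand f lam s‖ = Real.exp (-lam.re * s) * |f s| := by
  simp [laplaceIntegrand, Complex.norm_exp]

theorem laplaceIntegrand_real (f : ℝ → ℝ) (σ s : ℝ) :
    laplaceIntegrand f σ s = ((Real.exp (-σ * s) * f s : ℝ) : ℂ) := by
  simp [laplaceIntegrand]

theorem laplaceIntegrand_eq_exp_mul (f : ℝ → ℝ) (lam nu : ℂ) (s : ℝ) :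
    laplaceIntegrand f lam s = Complex.exp (-(lam - nu) * s) * laplaceIntegrand f nu s := by
  rw [laplaceIntegrand, laplaceIntegrand, ← mul_assoc, ← Complex.exp_add]
  ring_nf

theorem integrableOn_laplaceIntegrand {f : ℝ → ℝ} {σ : ℝ} {lam : ℂ}
    (hf : IntegrableOn (laplaceIntegrand f σ) (Ioi 0)) (hσ : σ ≤ lam.re) :
    IntegrableOn (laplaceIntegrand f lam) (Ioi 0) := by
  have h : IntegrableOn (fun s : ℝ => Complex.exp (-(lam - σ) * s) * laplaceIntegrand f σ s)
      (Ioi 0) := by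
    refine Integrable.bdd_mul (c := 1) hf (by fun_prop) ?_
    refine (ae_restrict_mem measurableSet_Ioi).mono fun s (hs : 0 < s) => ?_
    rw [Complex.norm_exp, Real.exp_le_one_iff]
    simp only [Complex.mul_re, Complex.neg_re, Complex.sub_re, Complex.ofReal_re,
      Complex.ofReal_im, mul_zero, sub_zero]
    nlinarith
  exact h.congr_fun (fun s _ => (laplaceIntegrand_eq_exp_mul f lam σ s).symm) measurableSet_Ioi

theorem norm_laplaceTransform_le {f : ℝ → ℝ} {σ : ℝ} {lam : ℂ}
    (hf : IntegrableOn (laplaceIntegrand f σ) (Ioi 0)) (hσ : σ ≤ lam.re) :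
    ‖laplaceTransform f lam‖ ≤ ∫ s in Ioi (0 : ℝ), ‖laplaceIntegrand f σ s‖ := by
  refine (norm_integral_le_integral_norm _).trans ?_
  refine setIntegral_mono_on (integrableOn_laplaceIntegrand hf hσ).norm hf.norm
    measurableSet_Ioi fun s (hs : 0 < s) => ?_
  rw [norm_laplaceIntegrand, norm_laplaceIntegrand, Complex.ofReal_re]
  gcongr

theorem differentiableAt_laplaceTransform {f : ℝ → ℝ} {σ : ℝ} {lam : ℂ}
    (hf : IntegrableOn (laplaceIntegrand f σ) (Ioi 0)) (hσ : σ < lam.re) :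
    DifferentiableAt ℂ (laplaceTransform f) lam := by
  -- Differentiating in `λ` produces a factor `s`. The gap between `σ` and the midpoint `τ` absorbs
  -- it, uniformly for `Re z > τ`.
  set τ := (σ + lam.re) / 2 with hτ
  have hτ1 : σ < τ := by linarith
  have hτ2 : τ < lam.re := by linarith
  have hs : {z : ℂ | τ < z.re} ∈ 𝓝 lam :=
    (isOpen_lt continuous_const Complex.continuous_re).mem_nhds hτ2
  have hbd : ∀ s : ℝ, 0 < s → s * Real.exp (-(τ - σ) * s) ≤ 1 / (τ - σ) := by
    intro s hs
    have h1 : (τ - σ) * s ≤ Real.exp ((τ - σ) * s) := by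
      linarith [Real.add_one_le_exp ((τ - σ) * s)]
    rw [le_div_iff₀ (by linarith), neg_mul, Real.exp_neg, ← div_eq_mul_inv, div_mul_eq_mul_div,
      div_le_one (Real.exp_pos _)]
    linarith
  refine (hasDerivAt_integral_of_dominated_loc_of_deriv_le (μ := volume.restrict (Ioi 0))
    (F := fun z s => laplaceIntegrand f z s)
    (F' := fun z s => -(s : ℂ) * laplaceIntegrand f z s)
    (bound := fun s => 1 / (τ - σ) * ‖laplaceIntegrand f σ s‖) hs ?_
    (integrableOn_laplaceIntegrand hf hσ.le) ?_ ?_ (hf.norm.const_mul _) ?_).2.differentiableAt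
  · filter_upwards [hs] with z hz
    exact (integrableOn_laplaceIntegrand hf (hτ1.trans hz).le).aestronglyMeasurable
  · exact (by fun_prop : Continuous fun s : ℝ => -(s : ℂ)).aestronglyMeasurable.mul
      (integrableOn_laplaceIntegrand hf hσ.le).aestronglyMeasurable
  · refine (ae_restrict_mem measurableSet_Ioi).mono fun s (hs : 0 < s) z (hz : τ < z.re) => ?_
    rw [norm_mul, norm_neg, Complex.norm_real, Real.norm_of_nonneg hs.le, norm_laplaceIntegrand,
      norm_laplaceIntegrand, Complex.ofReal_re, ← mul_assoc, ← mul_assoc]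
    refine mul_le_mul_of_nonneg_right ?_ (abs_nonneg _)
    calc s * Real.exp (-z.re * s) ≤ s * Real.exp (-τ * s) := by gcongr
      _ = s * Real.exp (-(τ - σ) * s) * Real.exp (-σ * s) := by
          rw [mul_assoc, ← Real.exp_add]; ring_nf
      _ ≤ _ := by gcongr; exact hbd s hs
  · refine Eventually.of_forall fun s z _ => ?_
    have h : HasDerivAt (fun z : ℂ => Complex.exp (-z * s) * (f s : ℂ))
        (Complex.exp (-z * s) * (-1 * s) * (f s : ℂ)) z :=
      (((hasDerivAt_id z).neg.mul_const (s : ℂ)).cexp).mul_const _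
    convert! h using 1
    simp only [laplaceIntegrand]; ring

/-- This bridge lets Plancherel and Fourier inversion act on vertical lines; the height is `2πw`
because the Fourier kernel is `e^{-2πiwt}`. -/
theorem indicator_laplaceIntegrand_fourier (f : ℝ → ℝ) (σ w : ℝ) :
    𝓕 ((Ioi (0 : ℝ)).indicator (laplaceIntegrand f σ)) w =
      laplaceTransform f (σ + (2 * Real.pi * w : ℝ) * Complex.I) := by
  rw [Real.fourier_real_eq_integral_exp_smul, laplaceTransform,
    ← integral_indicator measurableSet_Ioi]
  congr 1 with s
  by_cases hs : s ∈ Ioi (0 : ℝ)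
  · rw [indicator_of_mem hs, indicator_of_mem hs,
      laplaceIntegrand_eq_exp_mul f (σ + (2 * Real.pi * w : ℝ) * Complex.I) σ, smul_eq_mul]
    congr 2
    push_cast; ring
  · simp [indicator_of_notMem hs]

/-- The Laplace transform turns convolution products into products. The second factor is
supported in `[0, ∞)`. -/
theorem laplace_convolution {f z : ℝ → ℝ} {lam : ℂ} (hz0 : ∀ t ≤ 0, z t = 0)
    (hf : IntegrableOn (laplaceIntegrand f lam) (Ioi 0))
    (hz : IntegrableOn (laplaceIntegrand z lam) (Ioi 0)) :
    IntegrableOn (laplaceIntegrand (fun t => ∫ s in Ioi (0 : ℝ), f s * z (t - s)) lam) (Ioi 0) ∧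
    laplaceTransform (fun t => ∫ s in Ioi (0 : ℝ), f s * z (t - s)) lam =
      laplaceTransform f lam * laplaceTransform z lam := by
  have hf' := (integrable_indicator_iff measurableSet_Ioi).2 hf
  have hz' := (integrable_indicator_iff measurableSet_Ioi).2 hz
  -- The weight splits as `e^{-λt} = e^{-λs} e^{-λ(t-s)}`, so weighting commutes with convolution.
  -- As `z` vanishes on `(-∞, 0]`, truncating it changes nothing and the convolution is zero for `t
  -- ≤ 0`.
  have key : MeasureTheory.convolution ((Ioi (0 : ℝ)).indicator (laplaceIntegrand f lam))
      ((Ioi (0 : ℝ)).indicator (laplaceIntegrand z lam)) (ContinuousLinearMap.mul ℂ ℂ) volume =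
      (Ioi (0 : ℝ)).indicator
        (laplaceIntegrand (fun t => ∫ s in Ioi (0 : ℝ), f s * z (t - s)) lam) := by
    have hzi : (Ioi (0 : ℝ)).indicator (laplaceIntegrand z lam) = laplaceIntegrand z lam := by
      refine indicator_eq_self.2 fun t ht => ?_
      by_contra h
      exact ht (by simp [laplaceIntegrand, hz0 t (not_lt.1 h)])
    ext t
    have h1 : ∀ s, (ContinuousLinearMap.mul ℂ ℂ)
        ((Ioi (0 : ℝ)).indicator (laplaceIntegrand f lam) s) (laplaceIntegrand z lam (t - s)) =
        (Ioi (0 : ℝ)).indicator (fun s => Complex.exp (-lam * t) * ((f s * z (t - s) : ℝ) : ℂ)) s := by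
      intro s
      by_cases hs : s ∈ Ioi (0 : ℝ)
      · rw [indicator_of_mem hs, indicator_of_mem hs]
        simp only [laplaceIntegrand, ContinuousLinearMap.mul_apply']
        have : Complex.exp (-lam * t) = Complex.exp (-lam * s) * Complex.exp (-lam * (t - s : ℝ)) := by
          rw [← Complex.exp_add]; push_cast; ring_nf
        rw [this]; push_cast; ring
      · simp [indicator_of_notMem hs]
    rw [hzi, convolution_def]
    simp_rw [h1]
    rw [integral_indicator measurableSet_Ioi, integral_const_mul, integral_complex_ofReal]
    by_cases ht : t ∈ Ioi (0 : ℝ)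
    · rw [indicator_of_mem ht, laplaceIntegrand]
    · rw [indicator_of_notMem ht, setIntegral_eq_zero_of_forall_eq_zero]
      · simp
      · intro s (hs : 0 < s)
        rw [hz0 _ (by linarith [not_lt.1 (show ¬ 0 < t from ht)]), mul_zero]
  refine ⟨?_, ?_⟩
  · rw [← integrable_indicator_iff measurableSet_Ioi, ← key]
    exact hf'.integrable_convolution _ hz'
  · have h := integral_convolution (μ := (volume : Measure ℝ)) (ContinuousLinearMap.mul ℂ ℂ) hf' hz'
    rw [key] at h
    simpa only [integral_indicator measurableSet_Ioi, ContinuousLinearMap.mul_apply',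
      laplaceTransform] using h

/-! ### Contour shift -/

/-- Shifting the line of integration of a holomorphic function that decays in a vertical strip. -/
theorem integral_vertical_line_eq {F : ℂ → ℂ} {α γ C : ℝ} (hαγ : α ≤ γ)
    (hd : ∀ z : ℂ, α ≤ z.re → z.re ≤ γ → DifferentiableAt ℂ F z)
    (hC : ∀ z : ℂ, α ≤ z.re → z.re ≤ γ → ‖F z‖ ≤ C / (1 + |z.im|))
    (hα : Integrable fun y : ℝ => F (α + y * Complex.I))
    (hγ : Integrable fun y : ℝ => F (γ + y * Complex.I)) :
    ∫ y : ℝ, F (α + y * Complex.I) = ∫ y : ℝ, F (γ + y * Complex.I) := by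
  have hrect : ∀ T : ℝ, (∫ x : ℝ in α..γ, F (x + (-T : ℝ) * Complex.I)) -
      (∫ x : ℝ in α..γ, F (x + (T : ℝ) * Complex.I)) +
      Complex.I • (∫ y : ℝ in (-T)..T, F (γ + y * Complex.I)) -
      Complex.I • (∫ y : ℝ in (-T)..T, F (α + y * Complex.I)) = 0 := by
    intro T
    have := Complex.integral_boundary_rect_eq_zero_of_differentiableOn F
      (α + (-T : ℝ) * Complex.I) (γ + (T : ℝ) * Complex.I) ?_
    · simpa using this
    · intro z hz
      have h1 := hz.1
      simp only [mem_preimage, Complex.add_re, Complex.ofReal_re, Complex.mul_re, Complex.I_re,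
        Complex.I_im, Complex.ofReal_im, mul_zero, mul_one, sub_self, add_zero,
        uIcc_of_le hαγ] at h1
      exact (hd z h1.1 h1.2).differentiableWithinAt
  have hdiv : Tendsto (fun T : ℝ => C / (1 + |T|) * |γ - α|) atTop (𝓝 0) := by
    have : Tendsto (fun T : ℝ => 1 + |T|) atTop atTop :=
      tendsto_atTop_add_const_left _ _ tendsto_abs_atTop_atTop
    simpa using (this.const_div_atTop C).mul_const |γ - α|
  -- The sign `ε = ±1` treats the top and bottom sides of the rectangle together.
  have hz : ∀ ε : ℝ, |ε| = 1 →
      Tendsto (fun T : ℝ => ∫ x : ℝ in α..γ, F (x + (ε * T : ℝ) * Complex.I)) atTop (𝓝 0) := by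
    intro ε hε
    refine squeeze_zero_norm (fun T => ?_) hdiv
    refine intervalIntegral.norm_integral_le_of_norm_le_const fun x hx => ?_
    rw [uIoc_of_le hαγ] at hx
    have := hC (x + (ε * T : ℝ) * Complex.I) (by simpa using hx.1.le) (by simpa using hx.2)
    simpa [abs_mul, hε] using this
  have hv : ∀ σ : ℝ, Integrable (fun y : ℝ => F (σ + y * Complex.I)) →
      Tendsto (fun T : ℝ => ∫ y : ℝ in (-T)..T, F (σ + y * Complex.I)) atTop
        (𝓝 (∫ y : ℝ, F (σ + y * Complex.I))) := fun σ h =>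
    intervalIntegral_tendsto_integral h tendsto_neg_atTop_atBot tendsto_id
  have hlim := (((hz (-1) (by simp)).sub (hz 1 (by simp))).add ((hv γ hγ).const_smul Complex.I)).sub
    ((hv α hα).const_smul Complex.I)
  have h0 := tendsto_nhds_unique (hlim.congr fun T => by simpa using hrect T) tendsto_const_nhds
  simp only [sub_self, zero_add, smul_eq_mul, ← mul_sub] at h0
  exact (sub_eq_zero.1 ((mul_eq_zero.1 h0).resolve_left Complex.I_ne_zero)).symm

/-- Plancherel in the real-power form that Hölder's inequality for integrals uses. -/
theorem integral_norm_fourier_rpow_two {f : ℝ → ℂ} (hf : Integrable f) (hf2 : MemLp f 2) :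
    ∫ w, ‖𝓕 f w‖ ^ (2 : ℝ) = ∫ t, ‖f t‖ ^ (2 : ℝ) := by
  have h := eLpNorm_fourier_eq hf hf2
  rw [(memLp_two_fourier hf hf2).eLpNorm_eq_integral_rpow_norm (by norm_num) (by norm_num),
    hf2.eLpNorm_eq_integral_rpow_norm (by norm_num) (by norm_num),
    ENNReal.ofReal_eq_ofReal_iff (by positivity) (by positivity)] at h
  exact Real.rpow_left_injOn (x := (2 : ENNReal).toReal⁻¹) (by norm_num)
    (by simp only [mem_ofPred_eq]; positivity) (by simp only [mem_ofPred_eq]; positivity)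
    (by simpa using h)

/-- `integral_vertical_line_eq` with the frequency parametrization of vertical lines used by the
Fourier transform. -/
theorem integral_vertical_line_two_pi_eq {F : ℂ → ℂ} {α γ C : ℝ} (hαγ : α ≤ γ)
    (hd : ∀ z : ℂ, α ≤ z.re → z.re ≤ γ → DifferentiableAt ℂ F z)
    (hC : ∀ z : ℂ, α ≤ z.re → z.re ≤ γ → ‖F z‖ ≤ C / (1 + |z.im|))
    (hα : Integrable fun w : ℝ => F (α + (2 * Real.pi * w : ℝ) * Complex.I))
    (hγ : Integrable fun w : ℝ => F (γ + (2 * Real.pi * w : ℝ) * Complex.I)) :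
    ∫ w : ℝ, F (α + (2 * Real.pi * w : ℝ) * Complex.I) =
      ∫ w : ℝ, F (γ + (2 * Real.pi * w : ℝ) * Complex.I) := by
  have hp : (2 * Real.pi) ≠ 0 := by positivity
  have hα' := (integrable_comp_mul_left_iff (fun y : ℝ => F (α + y * Complex.I)) hp).1 hα
  have hγ' := (integrable_comp_mul_left_iff (fun y : ℝ => F (γ + y * Complex.I)) hp).1 hγ
  rw [Measure.integral_comp_mul_left (fun y : ℝ => F (α + y * Complex.I)),
    Measure.integral_comp_mul_left (fun y : ℝ => F (γ + y * Complex.I)),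
    integral_vertical_line_eq hαγ hd hC hα' hγ']

/-! ### Lower bounds for the characteristic function -/

theorem differentiableAt_charFunction {a b σ : ℝ} {K : ℝ → ℝ} {lam : ℂ}
    (hK : IntegrableOn (laplaceIntegrand K σ) (Ioi 0)) (hσ : σ < lam.re) :
    DifferentiableAt ℂ (charFunction a b K) lam :=
  (differentiableAt_id.sub_const _).sub
    ((differentiableAt_laplaceTransform hK hσ).const_mul _)

/-- The characteristic function differs from `λ` by a bounded function. -/
theorem norm_le_norm_charFunction_add {a b σ : ℝ} {K : ℝ → ℝ} {lam : ℂ}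
    (hK : IntegrableOn (laplaceIntegrand K σ) (Ioi 0)) (hσ : σ ≤ lam.re) :
    ‖lam‖ ≤ ‖charFunction a b K lam‖ +
      (|a| + |b| * ∫ s in Ioi (0 : ℝ), ‖laplaceIntegrand K σ s‖) := by
  have h : lam = charFunction a b K lam + ((a : ℂ) + b * laplaceTransform K lam) := by
    simp only [charFunction]; ring
  calc ‖lam‖ = ‖charFunction a b K lam + ((a : ℂ) + b * laplaceTransform K lam)‖ := by rw [← h]
    _ ≤ _ := by
      refine norm_add_le_of_le le_rfl (norm_add_le_of_le (by simp) ?_)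
      rw [norm_mul, Complex.norm_real, Real.norm_eq_abs]
      gcongr
      exact norm_laplaceTransform_le hK hσ

/-- High in the strip `h` is a bounded perturbation of `λ`; on the remaining compact rectangle it is
continuous and nonvanishing, so its modulus has a positive lower bound. -/
theorem exists_charFunction_lower_bound {a b σ α γ : ℝ} {K : ℝ → ℝ}
    (hK : IntegrableOn (laplaceIntegrand K σ) (Ioi 0)) (hσ : σ < α)
    (hroot : ∀ z : ℂ, α ≤ z.re → z.re ≤ γ → charFunction a b K z ≠ 0) :
    ∃ c : ℝ, 0 < c ∧ ∀ z : ℂ, α ≤ z.re → z.re ≤ γ → c * (1 + |z.im|) ≤ ‖charFunction a b K z‖ := by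
  set B : ℝ := |a| + |b| * ∫ s in Ioi (0 : ℝ), ‖laplaceIntegrand K σ s‖ with hB
  have hB0 : 0 ≤ B := by positivity
  -- This is the threshold at which `|Im z| - B ≥ (1 + |Im z|) / 2`.
  set R : ℝ := 2 * B + 1 with hR
  have hfar : ∀ z : ℂ, α ≤ z.re → R ≤ |z.im| →
      1 / 2 * (1 + |z.im|) ≤ ‖charFunction a b K z‖ := fun z h1 h2 => by
    have := norm_le_norm_charFunction_add (a := a) (b := b) hK (hσ.le.trans h1)
    linarith [Complex.abs_im_le_norm z]
  have hcomp : IsCompact (Icc α γ ×ℂ Icc (-R) R) := isCompact_Icc.reProdIm isCompact_Icc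
  have hcont : ContinuousOn (fun z => ‖charFunction a b K z‖) (Icc α γ ×ℂ Icc (-R) R) :=
    fun z hz => (differentiableAt_charFunction hK
      (hσ.trans_le hz.1.1)).continuousAt.norm.continuousWithinAt
  obtain ⟨m, hm, hmle⟩ : ∃ m : ℝ, 0 < m ∧
      ∀ z ∈ Icc α γ ×ℂ Icc (-R) R, m ≤ ‖charFunction a b K z‖ := by
    refine hcomp.exists_forall_le' hcont (a := 0) fun z hz => ?_
    exact norm_pos_iff.2 (hroot z hz.1.1 hz.1.2)
  refine ⟨min (1 / 2) (m / (1 + R)), by positivity, fun z h1 h2 => ?_⟩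
  rcases le_total R |z.im| with h | h
  · refine le_trans ?_ (hfar z h1 h)
    gcongr
    exact min_le_left _ _
  · refine le_trans ?_ (hmle z ⟨⟨h1, h2⟩, abs_le.1 h⟩)
    calc min (1 / 2) (m / (1 + R)) * (1 + |z.im|) ≤ m / (1 + R) * (1 + R) := by
          gcongr; exact min_le_right _ _
      _ = m := div_mul_cancel₀ _ (by positivity)

theorem memLp_two_inv_charFunction {a b σ α : ℝ} {K : ℝ → ℝ} {c : ℝ}
    (hK : IntegrableOn (laplaceIntegrand K σ) (Ioi 0)) (hσ : σ < α) (hc : 0 < c)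
    (hh : ∀ z : ℂ, z.re = α → c * (1 + |z.im|) ≤ ‖charFunction a b K z‖) :
    MemLp (fun w : ℝ => (charFunction a b K (α + (2 * Real.pi * w : ℝ) * Complex.I))⁻¹) 2 := by
  have hpos : ∀ z : ℂ, z.re = α → 0 < ‖charFunction a b K z‖ := fun z hz =>
    lt_of_lt_of_le (by positivity) (hh z hz)
  have hcont : Continuous
      fun w : ℝ => (charFunction a b K (α + (2 * Real.pi * w : ℝ) * Complex.I))⁻¹ := by
    refine Continuous.inv₀ ?_ fun w => norm_pos_iff.1 (hpos _ (by simp))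
    refine continuous_iff_continuousAt.2 fun w => ?_
    exact ContinuousAt.comp (f := fun w : ℝ => (α + (2 * Real.pi * w : ℝ) * Complex.I : ℂ))
      (differentiableAt_charFunction hK (by simpa using hσ)).continuousAt
      (by fun_prop)
  rw [memLp_two_iff_integrable_sq_norm hcont.aestronglyMeasurable]
  have hint : Integrable fun w : ℝ => c⁻¹ ^ 2 * (1 + ‖w‖) ^ (-(2 : ℝ)) :=
    (integrable_one_add_norm (by simp)).const_mul _
  refine hint.mono' (hcont.norm.pow 2).aestronglyMeasurable (Eventually.of_forall fun w => ?_)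
  have h1 := hh (α + (2 * Real.pi * w : ℝ) * Complex.I) (by simp)
  have h2 : |w| ≤ |2 * Real.pi * w| := by
    rw [abs_mul, abs_of_pos (by positivity : (0 : ℝ) < 2 * Real.pi)]
    exact le_mul_of_one_le_left (abs_nonneg w) (by linarith [Real.pi_gt_three])
  have h3 : c * (1 + |w|) ≤ ‖charFunction a b K (α + (2 * Real.pi * w : ℝ) * Complex.I)‖ := by
    refine le_trans ?_ h1
    simp only [Complex.add_im, Complex.ofReal_im, Complex.mul_im, Complex.ofReal_re,
      Complex.I_im, mul_one, Complex.I_re, mul_zero, add_zero, zero_add]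
    gcongr
  rw [norm_pow, norm_norm, norm_inv, Real.rpow_neg (by positivity), Real.rpow_two,
    ← inv_pow, ← mul_pow, ← mul_inv, Real.norm_eq_abs]
  gcongr

/-! ### Laplace integrands of exponentially bounded functions -/

section ExponentialDecay

variable {g : ℝ → ℝ} {M μ σ : ℝ}

theorem norm_laplaceIntegrand_le_of_decay (hM : ∀ t, 0 < t → |g t| ≤ M * Real.exp (-μ * t))
    {t : ℝ} (ht : 0 < t) :
    ‖laplaceIntegrand g σ t‖ ≤ M * Real.exp (-(σ + μ) * t) := by
  rw [norm_laplaceIntegrand, Complex.ofReal_re]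
  calc Real.exp (-σ * t) * |g t| ≤ Real.exp (-σ * t) * (M * Real.exp (-μ * t)) := by
        gcongr; exact hM t ht
    _ = M * (Real.exp (-σ * t) * Real.exp (-μ * t)) := by ring
    _ = _ := by rw [← Real.exp_add]; ring_nf

theorem aestronglyMeasurable_laplaceIntegrand
    (hg : AEStronglyMeasurable g (volume.restrict (Ioi 0))) (lam : ℂ) :
    AEStronglyMeasurable (laplaceIntegrand g lam) (volume.restrict (Ioi 0)) :=
  (by fun_prop : Continuous fun s : ℝ => Complex.exp (-lam * s)).aestronglyMeasurable.mul
    (Complex.continuous_ofReal.comp_aestronglyMeasurable hg)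

theorem integrableOn_laplaceIntegrand_of_decay
    (hg : AEStronglyMeasurable g (volume.restrict (Ioi 0)))
    (hM : ∀ t, 0 < t → |g t| ≤ M * Real.exp (-μ * t)) (hσ : -μ < σ) :
    IntegrableOn (laplaceIntegrand g σ) (Ioi 0) := by
  refine Integrable.mono' ((exp_neg_integrableOn_Ioi 0
    (by linarith : 0 < σ + μ)).const_mul M) (aestronglyMeasurable_laplaceIntegrand hg σ) ?_
  exact (ae_restrict_mem measurableSet_Ioi).mono fun t ht =>
    norm_laplaceIntegrand_le_of_decay hM ht

/-- The explicit factor `M ^ 2` makes the `L²` norm linear in `M`, which will be proportional to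
`‖φ‖`. -/
theorem memLp_two_laplaceIntegrand_of_decay
    (hg : AEStronglyMeasurable g (volume.restrict (Ioi 0)))
    (hM : ∀ t, 0 < t → |g t| ≤ M * Real.exp (-μ * t)) (hσ : -μ < σ) :
    MemLp ((Ioi (0 : ℝ)).indicator (laplaceIntegrand g σ)) 2 ∧
    ∫ t, ‖(Ioi (0 : ℝ)).indicator (laplaceIntegrand g σ) t‖ ^ (2 : ℝ) ≤
      M ^ 2 * (1 / (2 * (σ + μ))) := by
  have hneg : -(2 * (σ + μ)) < 0 := by linarith
  have hint : IntegrableOn (fun t : ℝ => M ^ 2 * Real.exp (-(2 * (σ + μ)) * t)) (Ioi 0) :=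
    (integrableOn_exp_mul_Ioi hneg 0).const_mul _
  have hle : ∀ t ∈ Ioi (0 : ℝ),
      ‖laplaceIntegrand g σ t‖ ^ 2 ≤ M ^ 2 * Real.exp (-(2 * (σ + μ)) * t) := fun t ht => by
    have h := pow_le_pow_left₀ (norm_nonneg _) (norm_laplaceIntegrand_le_of_decay (σ := σ) hM ht) 2
    rw [mul_pow, ← Real.exp_nat_mul] at h
    refine h.trans_eq ?_
    push_cast; ring_nf
  have hmeas := aestronglyMeasurable_laplaceIntegrand hg σ
  have hsq : IntegrableOn (fun t => ‖laplaceIntegrand g σ t‖ ^ 2) (Ioi 0) := by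
    refine Integrable.mono' hint (hmeas.norm.pow 2) ?_
    refine (ae_restrict_mem measurableSet_Ioi).mono fun t ht => ?_
    rw [norm_pow, norm_norm]
    exact hle t ht
  refine ⟨(memLp_indicator_iff_restrict measurableSet_Ioi).2
    ((memLp_two_iff_integrable_sq_norm hmeas).2 hsq), ?_⟩
  have hind : ∀ t, ‖(Ioi (0 : ℝ)).indicator (laplaceIntegrand g σ) t‖ ^ (2 : ℝ) =
      (Ioi (0 : ℝ)).indicator (fun t => ‖laplaceIntegrand g σ t‖ ^ 2) t := fun t => by
    by_cases ht : t ∈ Ioi (0 : ℝ)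
    · simp only [indicator_of_mem ht, Real.rpow_two]
    · simp [indicator_of_notMem ht]
  simp_rw [hind]
  rw [integral_indicator measurableSet_Ioi]
  refine (setIntegral_mono_on hsq hint measurableSet_Ioi hle).trans_eq ?_
  rw [integral_const_mul, integral_exp_mul_Ioi hneg]
  simp only [mul_zero, Real.exp_zero]
  rw [neg_div_neg_eq]

end ExponentialDecay

/-! ### Inversion and the `L²` estimate -/

/-- Exponential bound for a function whose Laplace transform is `ĝ / h`, where `h` has no zeros in
the strip `α ≤ Re λ ≤ γ`, obtained by moving the inversion integral to the line `Re λ = α`. -/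
theorem abs_le_of_laplaceTransform_eq {a b μ α γ c M : ℝ} {K g z : ℝ → ℝ}
    (hK : IntegrableOn (laplaceIntegrand K (-μ : ℝ)) (Ioi 0)) (hμα : -μ < α) (hαγ : α ≤ γ)
    (hc : 0 < c)
    (hh : ∀ z : ℂ, α ≤ z.re → z.re ≤ γ → c * (1 + |z.im|) ≤ ‖charFunction a b K z‖)
    (hg : AEStronglyMeasurable g (volume.restrict (Ioi 0))) (hM0 : 0 ≤ M)
    (hM : ∀ t, 0 < t → |g t| ≤ M * Real.exp (-μ * t))
    (hz : Continuous z) (hz0 : ∀ t ≤ 0, z t = 0)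
    (hzint : IntegrableOn (laplaceIntegrand z γ) (Ioi 0))
    (hzg : ∀ lam : ℂ, lam.re = γ →
      charFunction a b K lam * laplaceTransform z lam = laplaceTransform g lam) (t : ℝ) :
    |z t| ≤ (1 / (2 * (α + μ))) ^ (1 / 2 : ℝ) *
      (∫ w : ℝ, ‖(charFunction a b K (α + (2 * Real.pi * w : ℝ) * Complex.I))⁻¹‖ ^ (2 : ℝ)) ^
        (1 / 2 : ℝ) * M * Real.exp (α * t) := by
  have hne : ∀ lam : ℂ, α ≤ lam.re → lam.re ≤ γ → charFunction a b K lam ≠ 0 := fun lam h1 h2 =>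
    norm_pos_iff.1 (lt_of_lt_of_le (by positivity) (hh lam h1 h2))
  set F : ℂ → ℂ := fun lam =>
    Complex.exp (lam * t) * (laplaceTransform g lam * (charFunction a b K lam)⁻¹) with hF
  have hquot : ∀ σ : ℝ, α ≤ σ → σ ≤ γ → Integrable fun w : ℝ =>
      𝓕 ((Ioi (0 : ℝ)).indicator (laplaceIntegrand g σ)) w *
        (charFunction a b K (σ + (2 * Real.pi * w : ℝ) * Complex.I))⁻¹ := fun σ h1 h2 => by
    refine MemLp.integrable_mul (p := 2) (q := 2) (memLp_two_fourier
      ((integrable_indicator_iff measurableSet_Ioi).2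
        (integrableOn_laplaceIntegrand_of_decay hg hM (hμα.trans_le h1)))
      (memLp_two_laplaceIntegrand_of_decay hg hM (hμα.trans_le h1)).1)
      (memLp_two_inv_charFunction hK (hμα.trans_le h1) hc fun z hz => ?_)
    exact hh z (hz ▸ h1) (hz ▸ h2)
  have hFeq : ∀ σ w : ℝ, F (σ + (2 * Real.pi * w : ℝ) * Complex.I) =
      Complex.exp (σ * t) * (Complex.exp ((2 * Real.pi * (w * t) : ℝ) * Complex.I) *
        (𝓕 ((Ioi (0 : ℝ)).indicator (laplaceIntegrand g σ)) w *
        (charFunction a b K (σ + (2 * Real.pi * w : ℝ) * Complex.I))⁻¹)) := fun σ w => by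
    rw [indicator_laplaceIntegrand_fourier, ← mul_assoc (Complex.exp _) (Complex.exp _),
      ← Complex.exp_add]
    simp only [hF]
    congr 2
    push_cast; ring
  have hFint : ∀ σ : ℝ, α ≤ σ → σ ≤ γ →
      Integrable fun w : ℝ => F (σ + (2 * Real.pi * w : ℝ) * Complex.I) := fun σ h1 h2 => by
    simp_rw [hFeq]
    refine Integrable.const_mul (Integrable.bdd_mul (c := 1) (hquot σ h1 h2) (by fun_prop) ?_) _
    exact Eventually.of_forall fun w => (Complex.norm_exp_ofReal_mul_I _).le
  have hgα := integrableOn_laplaceIntegrand_of_decay hg hM hμα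
  have hshift : ∫ w : ℝ, F (α + (2 * Real.pi * w : ℝ) * Complex.I) =
      ∫ w : ℝ, F (γ + (2 * Real.pi * w : ℝ) * Complex.I) := by
    -- Holomorphy on the closed strip needs convergence strictly to the left of `α`; the midpoint of
    -- `-μ` and `α` serves.
    have hgσ := integrableOn_laplaceIntegrand_of_decay (σ := (α - μ) / 2) hg hM (by linarith)
    refine integral_vertical_line_two_pi_eq (C := Real.exp (max (α * t) (γ * t)) *
      ((∫ s in Ioi (0 : ℝ), ‖laplaceIntegrand g α s‖) * c⁻¹)) hαγ (fun z h1 h2 => ?_)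
      (fun z h1 h2 => ?_) (hFint α le_rfl hαγ) (hFint γ hαγ le_rfl)
    · exact (by fun_prop : DifferentiableAt ℂ (fun lam : ℂ => Complex.exp (lam * t)) z).mul
        ((differentiableAt_laplaceTransform hgσ (by linarith)).mul
          ((differentiableAt_charFunction hK (by linarith)).inv (hne z h1 h2)))
    · simp only [hF]
      rw [norm_mul, norm_mul, norm_inv, Complex.norm_exp, mul_div_assoc, mul_div_assoc,
        div_eq_mul_inv c⁻¹, ← mul_inv]
      have h3 : (z * t).re ≤ max (α * t) (γ * t) := by
        rw [Complex.re_mul_ofReal]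
        rcases le_total 0 t with ht | ht
        · exact le_max_of_le_right (by gcongr)
        · exact le_max_of_le_left (mul_le_mul_of_nonpos_right h1 ht)
      have h4 := hh z h1 h2
      have h5 := norm_laplaceTransform_le hgα h1
      gcongr
  -- Pointwise inversion applies because `e^{-γt} z(t)` is continuous and integrable, and its
  -- transform `ĝ/h` is integrable as a product of two `L²` functions.
  have hinv : (z t : ℂ) = ∫ w : ℝ, F (γ + (2 * Real.pi * w : ℝ) * Complex.I) := by
    have hZ : (Ioi (0 : ℝ)).indicator (laplaceIntegrand z γ) = laplaceIntegrand z γ := by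
      refine indicator_eq_self.2 fun t ht => ?_
      by_contra h
      exact ht (by simp [laplaceIntegrand, hz0 t (not_lt.1 h)])
    have hZc : Continuous (laplaceIntegrand z γ) := by
      unfold laplaceIntegrand; fun_prop
    have hZi : Integrable (laplaceIntegrand z γ) := by
      rw [← hZ]; exact (integrable_indicator_iff measurableSet_Ioi).2 hzint
    have hZf : 𝓕 (laplaceIntegrand z γ) = fun w : ℝ =>
        𝓕 ((Ioi (0 : ℝ)).indicator (laplaceIntegrand g γ)) w *
        (charFunction a b K (γ + (2 * Real.pi * w : ℝ) * Complex.I))⁻¹ := by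
      ext w
      rw [← hZ, indicator_laplaceIntegrand_fourier, indicator_laplaceIntegrand_fourier,
        ← hzg _ (by simp), mul_comm (charFunction _ _ _ _),
        mul_inv_cancel_right₀ (hne _ (by simpa using hαγ) (by simp))]
    have h := congrFun (hZc.fourierInv_fourier_eq hZi (by
      rw [hZf]; exact hquot γ hαγ le_rfl)) t
    rw [Real.fourierInv_eq', hZf] at h
    simp_rw [hFeq]
    rw [integral_const_mul]
    have h2 : (z t : ℂ) = Complex.exp (γ * t) * laplaceIntegrand z γ t := by
      rw [laplaceIntegrand, ← mul_assoc, ← Complex.exp_add]; simp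
    rw [h2, ← h]
    congr 1
    refine integral_congr_ae (Eventually.of_forall fun w => ?_)
    simp [mul_comm t w]
  obtain ⟨hG2, hGle⟩ := memLp_two_laplaceIntegrand_of_decay hg hM hμα
  have hG1 := (integrable_indicator_iff measurableSet_Ioi).2 hgα
  have hhol := integral_mul_norm_le_Lp_mul_Lq Real.HolderConjugate.two_two
    (f := 𝓕 ((Ioi (0 : ℝ)).indicator (laplaceIntegrand g α)))
    (g := fun w : ℝ => (charFunction a b K (α + (2 * Real.pi * w : ℝ) * Complex.I))⁻¹)
    (μ := (volume : Measure ℝ))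
    (by simpa using memLp_two_fourier hG1 hG2)
    (by simpa using memLp_two_inv_charFunction (a := a) (b := b) hK hμα hc
          (fun z hz => hh z hz.ge (hz.le.trans hαγ)))
  rw [integral_norm_fourier_rpow_two hG1 hG2] at hhol
  have hroot : (∫ t, ‖(Ioi (0 : ℝ)).indicator (laplaceIntegrand g α) t‖ ^ (2 : ℝ)) ^ (1 / 2 : ℝ) ≤
      M * (1 / (2 * (α + μ))) ^ (1 / 2 : ℝ) := by
    refine (Real.rpow_le_rpow (by positivity) hGle (by norm_num)).trans_eq ?_
    have : 0 ≤ 1 / (2 * (α + μ)) := by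
      have : 0 < α + μ := by linarith
      positivity
    rw [Real.mul_rpow (by positivity) this, ← Real.sqrt_eq_rpow, Real.sqrt_sq hM0]
  rw [← Real.norm_eq_abs, ← Complex.norm_real, hinv, ← hshift]
  refine (norm_integral_le_integral_norm _).trans ?_
  have hnorm : ∀ w : ℝ, ‖F (α + (2 * Real.pi * w : ℝ) * Complex.I)‖ = Real.exp (α * t) *
      (‖𝓕 ((Ioi (0 : ℝ)).indicator (laplaceIntegrand g α)) w‖ *
        ‖(charFunction a b K (α + (2 * Real.pi * w : ℝ) * Complex.I))⁻¹‖) := fun w => by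
    rw [hFeq, norm_mul, norm_mul, norm_mul, Complex.norm_exp_ofReal_mul_I, one_mul,
      Complex.norm_exp]
    simp
  simp_rw [hnorm]
  rw [integral_const_mul, mul_comm]
  gcongr
  refine hhol.trans ((mul_le_mul_of_nonneg_right hroot (by positivity)).trans_eq ?_)
  ring

/-! ### History integrals and a priori growth -/

theorem continuous_halfLine_convolution {K y : ℝ → ℝ} {B : ℝ} (hK : IntegrableOn K (Ioi 0))
    (hy : Continuous y) (hB : ∀ t, |y t| ≤ B) :
    Continuous fun t => ∫ s in Ioi (0 : ℝ), K s * y (t - s) := by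
  have h := BddAbove.continuous_convolution_right_of_integrable (μ := (volume : Measure ℝ))
    (ContinuousLinearMap.mul ℝ ℝ) (g := y) ⟨B, by rintro _ ⟨t, rfl⟩; exact hB t⟩
    ((integrable_indicator_iff measurableSet_Ioi).2 hK) hy
  refine h.congr fun t => ?_
  rw [convolution_def, ← integral_indicator measurableSet_Ioi]
  congr 1 with s
  by_cases hs : s ∈ Ioi (0 : ℝ)
  · simp [indicator_of_mem hs]
  · simp [indicator_of_notMem hs]

theorem integrableOn_history {K y : ℝ → ℝ} {t B : ℝ} (hK : IntegrableOn K (Ioi 0))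
    (hy : Continuous y) (hB : ∀ u ≤ t, |y u| ≤ B) :
    IntegrableOn (fun s => K s * y (t - s)) (Ioi 0) := by
  refine Integrable.mul_bdd (c := B) hK (by fun_prop) ?_
  exact (ae_restrict_mem measurableSet_Ioi).mono fun s (hs : 0 < s) => hB _ (by linarith)

/-- `K` is a probability density, so the history integral is an average of past values. -/
theorem abs_history_le {K y : ℝ → ℝ} {t B : ℝ} (hK0 : ∀ s, 0 ≤ s → 0 ≤ K s)
    (hK : IntegrableOn K (Ioi 0)) (hK1 : ∫ s in Ioi (0 : ℝ), K s = 1)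
    (hB : ∀ u ≤ t, |y u| ≤ B) : |∫ s in Ioi (0 : ℝ), K s * y (t - s)| ≤ B := by
  have h := norm_integral_le_of_norm_le (f := fun s => K s * y (t - s)) (hK.mul_const B)
    ((ae_restrict_mem measurableSet_Ioi).mono fun s (hs : 0 < s) => by
      rw [norm_mul, Real.norm_of_nonneg (hK0 s hs.le)]
      exact mul_le_mul_of_nonneg_left (hB _ (by linarith)) (hK0 s hs.le))
  rwa [integral_mul_const, hK1, one_mul] at h

section Solution

variable {a b μ : ℝ} {K : ℝ → ℝ} {φ : Iic (0 : ℝ) →ᵇ ℝ} {x : ℝ → ℝ}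

theorem IsDelaySolution.abs_le_of_nonpos (hx : IsDelaySolution a b K φ x) {u : ℝ} (hu : u ≤ 0) :
    |x u| ≤ ‖φ‖ := by
  rw [hx.1 ⟨u, hu⟩]
  exact φ.norm_coe_le_norm _

theorem IsDelaySolution.continuous (hx : IsDelaySolution a b K φ x) : Continuous x := by
  have h1 : Continuous fun t : ℝ => x (max t 0) :=
    ContinuousOn.comp_continuous (s := Ici 0) (fun t ht => (hx.2 t ht).continuousWithinAt)
      (by fun_prop) fun t => le_max_right t 0
  have h2 : Continuous fun t : ℝ => φ ⟨min t 0, mem_Iic.2 (min_le_right t 0)⟩ :=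
    φ.continuous.comp (by fun_prop)
  -- One of the first two terms always equals `x 0`, so the sum is `x t`.
  have h3 : Continuous fun t : ℝ => x (max t 0) + x (min t 0) - x 0 :=
    (h1.add (h2.congr fun t => (hx.1 _).symm)).sub continuous_const
  refine h3.congr fun t => ?_
  rcases le_total t 0 with ht | ht
  · simp [ht]
  · simp [ht]

/-- A priori exponential growth bound for solutions. -/
theorem IsDelaySolution.abs_le_exp (hK0 : ∀ s, 0 ≤ s → 0 ≤ K s) (hK : IntegrableOn K (Ioi 0))
    (hK1 : ∫ s in Ioi (0 : ℝ), K s = 1) (hx : IsDelaySolution a b K φ x) {t : ℝ} (ht : 0 ≤ t) :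
    |x t| ≤ ‖φ‖ * Real.exp ((|a| + |b| + 1) * t) := by
  set L := |a| + |b| + 1 with hL
  have hLpos : 0 < L := by positivity
  -- Let `N` be the maximum of `|x s| e^{-Ls}`, attained at `s₀`. If `N > ‖φ‖`, the history up to
  -- time `s` is at most `N e^{Ls}`, and integrating the equation gives `N e^{Ls₀} = |x s₀| ≤ ‖φ‖ +
  -- N (e^{Ls₀} - 1)`, that is `N ≤ ‖φ‖`.
  obtain ⟨s₀, hs₀, hmax⟩ := isCompact_Icc.exists_isMaxOn (nonempty_Icc.2 ht)
    (by have := hx.continuous; fun_prop :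
      ContinuousOn (fun s => |x s| * Real.exp (-(L * s))) (Icc 0 t))
  set N := |x s₀| * Real.exp (-(L * s₀)) with hN
  have hxN : ∀ s ∈ Icc 0 t, |x s| ≤ N * Real.exp (L * s) := fun s hs => by
    have h : |x s| * Real.exp (-(L * s)) ≤ N := hmax hs
    rwa [Real.exp_neg, ← div_eq_mul_inv, div_le_iff₀ (Real.exp_pos _)] at h
  suffices hNφ : N ≤ ‖φ‖ from (hxN t ⟨ht, le_rfl⟩).trans (by gcongr)
  by_contra! hlt
  have hN0 : 0 ≤ N := by positivity
  have hhist : ∀ s ∈ Icc 0 t, ∀ u ≤ s, |x u| ≤ N * Real.exp (L * s) := fun s hs u hu => by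
    rcases le_total u 0 with h | h
    · calc |x u| ≤ N * 1 := by linarith [hx.abs_le_of_nonpos h]
        _ ≤ _ := by gcongr; exact Real.one_le_exp (mul_nonneg hLpos.le hs.1)
    · refine (hxN u ⟨h, hu.trans hs.2⟩).trans ?_
      gcongr
  have hB : ∀ s : ℝ, HasDerivAt (fun s => ‖φ‖ + N * (Real.exp (L * s) - 1))
      (N * (Real.exp (L * s) * (L * 1))) s := fun s =>
    ((((hasDerivAt_id s).const_mul L).exp.sub_const 1).const_mul N).const_add _
  have hfence := image_norm_le_of_norm_deriv_right_le_deriv_boundary (a := 0) (b := s₀)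
    (f := x) hx.continuous.continuousOn
    (fun s hs => (hx.2 s hs.1).mono (Ici_subset_Ici.2 hs.1))
    (B := fun s => ‖φ‖ + N * (Real.exp (L * s) - 1))
    (by simpa using hx.abs_le_of_nonpos le_rfl) hB (fun s hs => by
      have hs' : s ∈ Icc 0 t := ⟨hs.1, hs.2.le.trans hs₀.2⟩
      have h1 := hxN s hs'
      have h2 := abs_history_le hK0 hK hK1 (hhist s hs')
      calc ‖a * x s + b * ∫ r in Ioi (0 : ℝ), K r * x (s - r)‖
          ≤ |a| * |x s| + |b| * |∫ r in Ioi (0 : ℝ), K r * x (s - r)| :=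
            norm_add_le_of_le (norm_mul_le _ _) (norm_mul_le _ _)
        _ ≤ |a| * (N * Real.exp (L * s)) + |b| * (N * Real.exp (L * s)) := by gcongr
        _ = (|a| + |b|) * (N * Real.exp (L * s)) := by ring
        _ ≤ L * (N * Real.exp (L * s)) := by gcongr; linarith
        _ = _ := by ring) (right_mem_Icc.2 hs₀.1)
  have hs₀N : |x s₀| = N * Real.exp (L * s₀) := by
    rw [hN, mul_assoc, ← Real.exp_add]; simp
  rw [Real.norm_eq_abs, hs₀N] at hfence
  linarith

/-! ### Reduction to zero history and the transformed equation -/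

/-- The extension of an initial function to the line by `φ(0) e^{-μ t}` for `t ≥ 0`. -/
noncomputable def expExtension (μ : ℝ) (φ : Iic (0 : ℝ) →ᵇ ℝ) (t : ℝ) : ℝ :=
  φ ⟨min t 0, mem_Iic.2 (min_le_right t 0)⟩ * Real.exp (-μ * max t 0)

theorem continuous_expExtension : Continuous (expExtension μ φ) := by
  have h2 : Continuous fun t : ℝ => φ ⟨min t 0, mem_Iic.2 (min_le_right t 0)⟩ :=
    φ.continuous.comp (by fun_prop)
  exact h2.mul (by fun_prop)

theorem abs_expExtension_le_exp_max (t : ℝ) :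
    |expExtension μ φ t| ≤ ‖φ‖ * Real.exp (-μ * max t 0) := by
  rw [expExtension, abs_mul, abs_of_pos (Real.exp_pos _)]
  gcongr
  exact φ.norm_coe_le_norm _

theorem abs_expExtension_le (hμ : 0 ≤ μ) (t : ℝ) : |expExtension μ φ t| ≤ ‖φ‖ := by
  refine (abs_expExtension_le_exp_max t).trans (mul_le_of_le_one_right (norm_nonneg _) ?_)
  rw [Real.exp_le_one_iff]
  nlinarith [le_max_right t 0]

/-- The bound also holds for `t < 0`, where `e^{-μt} ≥ 1`; history integrals can thus be estimated
without splitting at `s = t`. -/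
theorem abs_expExtension_le_exp (hμ : 0 ≤ μ) (t : ℝ) :
    |expExtension μ φ t| ≤ ‖φ‖ * Real.exp (-μ * t) := by
  refine (abs_expExtension_le_exp_max t).trans ?_
  gcongr ?_ * Real.exp ?_
  nlinarith [le_max_left t 0]

theorem hasDerivAt_expExtension {t : ℝ} (ht : 0 < t) :
    HasDerivAt (expExtension μ φ) (-μ * expExtension μ φ t) t := by
  have heq : ∀ s : ℝ, 0 < s → expExtension μ φ s = φ ⟨0, mem_Iic.2 le_rfl⟩ * Real.exp (-μ * s) :=
    fun s hs => by simp [expExtension, hs.le]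
  have h : HasDerivAt (fun s => φ ⟨0, mem_Iic.2 le_rfl⟩ * Real.exp (-μ * s))
      (φ ⟨0, mem_Iic.2 le_rfl⟩ * (Real.exp (-μ * t) * (-μ * 1))) t :=
    ((hasDerivAt_id t).const_mul (-μ)).exp.const_mul _
  refine (h.congr_of_eventuallyEq ?_).congr_deriv ?_
  · filter_upwards [Ioi_mem_nhds ht] with s hs using heq s hs
  · rw [heq t ht]; ring

/-- The inhomogeneity in the equation for the difference of a solution and `expExtension`. -/
noncomputable def expForcing (a b μ : ℝ) (K : ℝ → ℝ) (φ : Iic (0 : ℝ) →ᵇ ℝ) (t : ℝ) : ℝ :=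
  (a + μ) * expExtension μ φ t + b * ∫ s in Ioi (0 : ℝ), K s * expExtension μ φ (t - s)

theorem continuous_expForcing (hK : IntegrableOn K (Ioi 0)) (hμ : 0 ≤ μ) :
    Continuous (expForcing a b μ K φ) :=
  (continuous_expExtension.const_mul _).add ((continuous_halfLine_convolution hK
    continuous_expExtension (abs_expExtension_le hμ)).const_mul _)

/-- Writing `e^{-μ(t-s)} = e^{μs} e^{-μt}`, the history term costs exactly the exponential moment of
`K`. -/
theorem abs_expForcing_le (hK : IntegrableOn (laplaceIntegrand K (-μ : ℝ)) (Ioi 0))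
    (hμ : 0 ≤ μ) (t : ℝ) :
    |expForcing a b μ K φ t| ≤
      (|a| + μ + |b| * ∫ s in Ioi (0 : ℝ), ‖laplaceIntegrand K (-μ : ℝ) s‖) * ‖φ‖ *
        Real.exp (-μ * t) := by
  have h1 := abs_expExtension_le_exp (φ := φ) hμ t
  have h2 : |∫ s in Ioi (0 : ℝ), K s * expExtension μ φ (t - s)| ≤
      (∫ s in Ioi (0 : ℝ), ‖laplaceIntegrand K (-μ : ℝ) s‖) * (‖φ‖ * Real.exp (-μ * t)) := by
    rw [← integral_mul_const]
    rw [← Real.norm_eq_abs]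
    refine norm_integral_le_of_norm_le (hK.norm.mul_const _) (Eventually.of_forall fun s => ?_)
    rw [norm_laplaceIntegrand, Complex.ofReal_re, norm_mul, Real.norm_eq_abs, Real.norm_eq_abs]
    calc |K s| * |expExtension μ φ (t - s)| ≤ |K s| * (‖φ‖ * Real.exp (-μ * (t - s))) := by
          gcongr; exact abs_expExtension_le_exp hμ _
      _ = |K s| * (‖φ‖ * (Real.exp (- -μ * s) * Real.exp (-μ * t))) := by
          rw [← Real.exp_add]; ring_nf
      _ = _ := by ring
  rw [expForcing]
  calc |(a + μ) * expExtension μ φ t + b * ∫ s in Ioi (0 : ℝ), K s * expExtension μ φ (t - s)|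
      ≤ |a + μ| * |expExtension μ φ t| +
        |b| * |∫ s in Ioi (0 : ℝ), K s * expExtension μ φ (t - s)| :=
        (abs_add_le _ _).trans_eq (by rw [abs_mul, abs_mul])
    _ ≤ (|a| + μ) * (‖φ‖ * Real.exp (-μ * t)) + |b| *
        ((∫ s in Ioi (0 : ℝ), ‖laplaceIntegrand K (-μ : ℝ) s‖) * (‖φ‖ * Real.exp (-μ * t))) := by
        gcongr
        exact (abs_add_le a μ).trans_eq (by rw [abs_of_nonneg hμ])
    _ = _ := by ring

theorem IsDelaySolution.sub_expExtension_of_nonpos (hx : IsDelaySolution a b K φ x) {t : ℝ}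
    (ht : t ≤ 0) : x t - expExtension μ φ t = 0 := by
  have : x t = φ ⟨t, ht⟩ := hx.1 ⟨t, ht⟩
  simp [expExtension, ht, this]

theorem IsDelaySolution.abs_sub_expExtension_le (hK0 : ∀ s, 0 ≤ s → 0 ≤ K s)
    (hK : IntegrableOn K (Ioi 0)) (hK1 : ∫ s in Ioi (0 : ℝ), K s = 1) (hμ : 0 ≤ μ)
    (hx : IsDelaySolution a b K φ x) {t : ℝ} (ht : 0 ≤ t) :
    |x t - expExtension μ φ t| ≤ 2 * ‖φ‖ * Real.exp ((|a| + |b| + 1) * t) := by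
  have h1 := hx.abs_le_exp hK0 hK hK1 ht
  have h2 := abs_expExtension_le (φ := φ) hμ t
  have h3 : ‖φ‖ * 1 ≤ ‖φ‖ * Real.exp ((|a| + |b| + 1) * t) := by
    gcongr; exact Real.one_le_exp (by positivity)
  linarith [abs_sub (x t) (expExtension μ φ t)]

theorem IsDelaySolution.hasDerivAt_sub_expExtension (hK0 : ∀ s, 0 ≤ s → 0 ≤ K s)
    (hK : IntegrableOn K (Ioi 0)) (hK1 : ∫ s in Ioi (0 : ℝ), K s = 1) (hμ : 0 ≤ μ)
    (hx : IsDelaySolution a b K φ x) {t : ℝ} (ht : 0 < t) :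
    HasDerivAt (fun t => x t - expExtension μ φ t)
      (a * (x t - expExtension μ φ t) +
        b * (∫ s in Ioi (0 : ℝ), K s * (x (t - s) - expExtension μ φ (t - s))) +
        expForcing a b μ K φ t) t := by
  refine (((hx.2 t ht.le).hasDerivAt (Ici_mem_nhds ht)).sub
    (hasDerivAt_expExtension ht)).congr_deriv ?_
  have hxb : ∀ u ≤ t, |x u| ≤ ‖φ‖ * Real.exp ((|a| + |b| + 1) * t) := fun u hu => by
    rcases le_total u 0 with h | h
    · exact (hx.abs_le_of_nonpos h).trans
        (le_mul_of_one_le_right (norm_nonneg _) (Real.one_le_exp (by positivity)))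
    · refine (hx.abs_le_exp hK0 hK hK1 h).trans ?_
      gcongr
  have hsub := integral_sub (integrableOn_history hK hx.continuous hxb)
    (integrableOn_history hK continuous_expExtension
      (fun u (_ : u ≤ t) => abs_expExtension_le (φ := φ) hμ u))
  simp_rw [mul_sub (K _)]
  rw [hsub, expForcing]
  ring

/-- Integrate the derivative of `e^{-λt} z(t)` over `(0, ∞)`. Both boundary terms vanish: `z(0) =
0`, and `Re λ` exceeds the growth exponent. -/
theorem IsDelaySolution.laplaceTransform_sub_expExtension (hK0 : ∀ s, 0 ≤ s → 0 ≤ K s)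
    (hK : IntegrableOn K (Ioi 0)) (hK1 : ∫ s in Ioi (0 : ℝ), K s = 1) (hμ : 0 < μ)
    (hKμ : IntegrableOn (laplaceIntegrand K (-μ : ℝ)) (Ioi 0))
    (hx : IsDelaySolution a b K φ x) {lam : ℂ} (hlam : |a| + |b| + 1 < lam.re) :
    IntegrableOn (laplaceIntegrand (fun t => x t - expExtension μ φ t) lam) (Ioi 0) ∧
    charFunction a b K lam * laplaceTransform (fun t => x t - expExtension μ φ t) lam =
      laplaceTransform (expForcing a b μ K φ) lam := by
  set z : ℝ → ℝ := fun t => x t - expExtension μ φ t with hz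
  have hlam0 : 0 < lam.re := lt_trans (by positivity) hlam
  have hzc : Continuous z := hx.continuous.sub continuous_expExtension
  have hz0 : ∀ t ≤ 0, z t = 0 := fun t ht => hx.sub_expExtension_of_nonpos ht
  -- Growth is written as decay at a negative rate, so that the decay lemmas apply.
  have hzb : ∀ t, 0 < t → |z t| ≤ 2 * ‖φ‖ * Real.exp (-(-(|a| + |b| + 1)) * t) := fun t ht => by
    rw [neg_neg]; exact hx.abs_sub_expExtension_le hK0 hK hK1 hμ.le ht.le
  have hzi : IntegrableOn (laplaceIntegrand z lam) (Ioi 0) :=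
    integrableOn_laplaceIntegrand (integrableOn_laplaceIntegrand_of_decay
      hzc.aestronglyMeasurable hzb (by rwa [neg_neg])) le_rfl
  have hgi : IntegrableOn (laplaceIntegrand (expForcing a b μ K φ) lam) (Ioi 0) :=
    integrableOn_laplaceIntegrand (integrableOn_laplaceIntegrand_of_decay
      (continuous_expForcing hK hμ.le).aestronglyMeasurable
      (fun t _ => abs_expForcing_le hKμ hμ.le t) (by linarith : -μ < lam.re)) le_rfl
  have hKi : IntegrableOn (laplaceIntegrand K lam) (Ioi 0) :=
    integrableOn_laplaceIntegrand hKμ (by linarith)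
  obtain ⟨hci, hcl⟩ := laplace_convolution hz0 hKi hzi
  refine ⟨hzi, ?_⟩
  have hderiv : ∀ t ∈ Ioi (0 : ℝ), HasDerivAt (laplaceIntegrand z lam)
      (((a : ℂ) - lam) * laplaceIntegrand z lam t +
        (b : ℂ) * laplaceIntegrand (fun t => ∫ s in Ioi (0 : ℝ), K s * z (t - s)) lam t +
        laplaceIntegrand (expForcing a b μ K φ) lam t) t := fun t ht => by
    have h1 := (hx.hasDerivAt_sub_expExtension hK0 hK hK1 hμ.le ht).ofReal_comp
    have h2 : HasDerivAt (fun s : ℝ => Complex.exp (-lam * s))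
        (Complex.exp (-lam * t) * (-lam * 1)) t :=
      (Complex.ofRealCLM.hasDerivAt.const_mul (-lam)).cexp
    refine (h2.mul h1).congr_deriv ?_
    simp only [laplaceIntegrand, hz]
    push_cast
    ring
  have htend : Tendsto (laplaceIntegrand z lam) atTop (𝓝 0) := by
    have hlim : Tendsto (fun t : ℝ => 2 * ‖φ‖ *
        Real.exp (-((lam.re + -(|a| + |b| + 1)) * t))) atTop (𝓝 0) := by
      have : Tendsto (fun t : ℝ => (lam.re + -(|a| + |b| + 1)) * t) atTop atTop :=
        tendsto_id.const_mul_atTop (by linarith)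
      simpa using (Real.tendsto_exp_neg_atTop_nhds_zero.comp this).const_mul (2 * ‖φ‖)
    refine squeeze_zero_norm' ?_ hlim
    filter_upwards [eventually_gt_atTop 0] with t ht
    have h := norm_laplaceIntegrand_le_of_decay (σ := lam.re) hzb ht
    rw [norm_laplaceIntegrand] at h ⊢
    rwa [Complex.ofReal_re, neg_mul (lam.re + _)] at h
  have hzc' : Continuous (laplaceIntegrand z lam) := by
    unfold laplaceIntegrand; fun_prop
  have hint := integral_Ioi_of_hasDerivAt_of_tendsto hzc'.continuousWithinAt hderiv
    (((hzi.const_mul _).add (hci.const_mul _)).add hgi) htend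
  rw [integral_add (by exact (hzi.const_mul _).add (hci.const_mul _)) hgi,
    integral_add (hzi.const_mul _) (hci.const_mul _), integral_const_mul, integral_const_mul] at hint
  change (a - lam) * laplaceTransform z lam + b * laplaceTransform _ lam +
    laplaceTransform _ lam = _ at hint
  rw [hcl, laplaceIntegrand, hz0 0 le_rfl] at hint
  simp only [Complex.ofReal_zero, mul_zero, sub_zero] at hint
  rw [charFunction]
  linear_combination -hint

end Solution

/-! ### The exponential estimate -/

/-- The exponential estimate for all solutions. -/
theorem exists_exponential_bound {a b μ α : ℝ} {K : ℝ → ℝ} (hK0 : ∀ s, 0 ≤ s → 0 ≤ K s)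
    (hK : IntegrableOn K (Ioi 0)) (hK1 : ∫ s in Ioi (0 : ℝ), K s = 1) (hμ : 0 < μ)
    (hKμ : IntegrableOn (laplaceIntegrand K (-μ : ℝ)) (Ioi 0)) (hμα : -μ < α)
    (hroot : ∀ z : ℂ, α ≤ z.re → charFunction a b K z ≠ 0) :
    ∃ K₁ : ℝ, 0 < K₁ ∧ ∀ (φ : Iic (0 : ℝ) →ᵇ ℝ) (x : ℝ → ℝ), IsDelaySolution a b K φ x →
      ∀ t : ℝ, 0 ≤ t → |x t| ≤ K₁ * ‖φ‖ * Real.exp (α * t) := by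
  set γ := max α (|a| + |b| + 2) with hγ
  have hαγ : α ≤ γ := le_max_left _ _
  have hLγ : |a| + |b| + 1 < γ := lt_of_lt_of_le (by linarith) (le_max_right _ _)
  obtain ⟨c, hc, hh⟩ := exists_charFunction_lower_bound (γ := γ) hKμ hμα
    fun z h1 _ => hroot z h1
  set C : ℝ := (1 / (2 * (α + μ))) ^ (1 / 2 : ℝ) *
      (∫ w : ℝ, ‖(charFunction a b K (α + (2 * Real.pi * w : ℝ) * Complex.I))⁻¹‖ ^ (2 : ℝ)) ^
        (1 / 2 : ℝ) with hC
  set D : ℝ := |a| + μ + |b| * ∫ s in Ioi (0 : ℝ), ‖laplaceIntegrand K (-μ : ℝ) s‖ with hD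
  have hαμ : 0 < α + μ := by linarith
  have hD0 : 0 ≤ D := by positivity
  -- `C * D` bounds the difference, with `D` coming from the forcing; the `1` pays for the
  -- extension, since `-μ < α`.
  refine ⟨C * D + 1, by positivity, fun φ x hx t ht => ?_⟩
  have hlap := fun lam : ℂ => hx.laplaceTransform_sub_expExtension hK0 hK hK1 hμ hKμ (lam := lam)
  have h1 := abs_le_of_laplaceTransform_eq hKμ hμα hαγ hc hh
    (continuous_expForcing hK hμ.le).aestronglyMeasurable (by positivity : 0 ≤ D * ‖φ‖)
    (fun t _ => abs_expForcing_le (φ := φ) hKμ hμ.le t)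
    (hx.continuous.sub continuous_expExtension)
    (fun t ht => hx.sub_expExtension_of_nonpos ht) (hlap γ (by simpa using hLγ)).1
    (fun lam h => (hlap lam (h ▸ hLγ)).2) t
  have h2 : |expExtension μ φ t| ≤ ‖φ‖ * Real.exp (α * t) :=
    (abs_expExtension_le_exp hμ.le t).trans (by gcongr)
  calc |x t| = |(x t - expExtension μ φ t) + expExtension μ φ t| := by rw [sub_add_cancel]
    _ ≤ C * (D * ‖φ‖) * Real.exp (α * t) + ‖φ‖ * Real.exp (α * t) :=
        (abs_add_le _ _).trans (add_le_add h1 h2)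
    _ = _ := by ring

/-! ### Roots in the closed right half-plane and instability -/

theorem re_le_alphaZero {a b : ℝ} {K : ℝ → ℝ} {lam : ℂ} (h : lam ∈ charRoots a b K) :
    ((lam.re : ℝ) : EReal) ≤ alphaZero a b K :=
  le_sSup ⟨lam, h, rfl⟩

/-- Since the roots in `Re λ ≥ -μ/2` form a compact set, `α₀ ≥ 0` forces a root with `Re λ ≥ 0`. -/
theorem exists_root_of_zero_le_alphaZero {a b μ : ℝ} {K : ℝ → ℝ} (hμ : 0 < μ)
    (hKμ : IntegrableOn (laplaceIntegrand K (-μ : ℝ)) (Ioi 0)) (h0 : 0 ≤ alphaZero a b K) :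
    ∃ lam : ℂ, 0 ≤ lam.re ∧ charFunction a b K lam = 0 := by
  by_contra! hno
  -- At a root with `Re λ ≥ -μ`, the equation itself gives `‖λ‖ ≤ B`. Cutting at `-μ/2` keeps the
  -- closed region inside `Re λ > -μ`, where `h` is known to be continuous.
  set B : ℝ := |a| + |b| * ∫ s in Ioi (0 : ℝ), ‖laplaceIntegrand K (-μ : ℝ) s‖ with hB
  set A : Set ℂ := Metric.closedBall 0 B ∩ {z | -μ / 2 ≤ z.re} with hA
  have hAcl : IsClosed {z : ℂ | -μ / 2 ≤ z.re} := isClosed_le continuous_const Complex.continuous_re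
  have hcont : ContinuousOn (charFunction a b K) A := fun z hz =>
    (differentiableAt_charFunction hKμ
      (by have : -μ / 2 ≤ z.re := hz.2
          linarith)).continuousAt.continuousWithinAt
  have hcomp : IsCompact (A ∩ charFunction a b K ⁻¹' {0}) := by
    refine ((isCompact_closedBall 0 B).inter_right hAcl).of_isClosed_subset ?_ inter_subset_left
    exact hcont.preimage_isClosed_of_isClosed (Metric.isClosed_closedBall.inter hAcl)
      isClosed_singleton
  have hmem : ∀ z : ℂ, -μ / 2 ≤ z.re → charFunction a b K z = 0 →
      z ∈ A ∩ charFunction a b K ⁻¹' {0} := fun z h1 h2 => by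
    have h := norm_le_norm_charFunction_add (a := a) (b := b) hKμ
      (by linarith : -μ ≤ z.re)
    rw [h2, norm_zero, zero_add] at h
    exact ⟨⟨mem_closedBall_zero_iff.2 h, h1⟩, h2⟩
  obtain ⟨m, hm0, hm⟩ : ∃ m : ℝ, m < 0 ∧ ∀ z ∈ A ∩ charFunction a b K ⁻¹' {0}, z.re ≤ m := by
    obtain ⟨m, hm0, hm⟩ := hcomp.exists_forall_le' Complex.continuous_re.neg.continuousOn (a := 0)
      fun z hz => by
        by_contra! h
        exact hno z (neg_nonpos.1 h) hz.2
    exact ⟨-m, neg_lt_zero.2 hm0, fun z hz => le_neg_of_le_neg (hm z hz)⟩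
  have hle : alphaZero a b K ≤ ((max m (-μ / 2) : ℝ) : EReal) := by
    refine sSup_le ?_
    rintro _ ⟨z, hz, rfl⟩
    refine EReal.coe_le_coe_iff.2 ?_
    rcases le_total (-μ / 2) z.re with h | h
    · exact le_max_of_le_left (hm z (hmem z h hz.2))
    · exact le_max_of_le_right h
  have := EReal.coe_nonneg.1 (h0.trans hle)
  exact absurd this (not_le.2 (max_lt hm0 (by linarith)))

/-- Real parts of exponentials `e^{λ t}` at roots `λ` are solutions. -/
theorem isDelaySolution_exp {a b ε : ℝ} {K : ℝ → ℝ} {φ : Iic (0 : ℝ) →ᵇ ℝ} {lam : ℂ}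
    (hK : IntegrableOn (laplaceIntegrand K lam) (Ioi 0)) (hroot : charFunction a b K lam = 0)
    (hφ : ∀ θ : Iic (0 : ℝ), φ θ = ε * (Complex.exp (lam * (θ : ℝ))).re) :
    IsDelaySolution a b K φ fun t => ε * (Complex.exp (lam * t)).re := by
  refine ⟨fun θ => (hφ θ).symm, fun t _ => ?_⟩
  have hd : HasDerivAt (fun t : ℝ => Complex.exp (lam * t)) (Complex.exp (lam * t) * (lam * 1)) t :=
    (Complex.ofRealCLM.hasDerivAt.const_mul lam).cexp
  have hre : HasDerivAt (fun t : ℝ => ε * (Complex.exp (lam * t)).re)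
      (ε * (Complex.exp (lam * t) * (lam * 1)).re) t :=
    (Complex.reCLM.hasFDerivAt.comp_hasDerivAt t hd).const_mul ε
  refine (hre.congr_deriv ?_).hasDerivWithinAt
  have hint : ∫ s in Ioi (0 : ℝ), K s * (ε * (Complex.exp (lam * (t - s : ℝ))).re) =
      ε * (Complex.exp (lam * t) * laplaceTransform K lam).re := by
    rw [laplaceTransform, ← integral_const_mul, ← Complex.reCLM_apply,
      ← ContinuousLinearMap.integral_comp_comm _ (hK.const_mul _), ← integral_const_mul]
    refine integral_congr_ae (Eventually.of_forall fun s => ?_)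
    have : Complex.exp (lam * (t - s : ℝ)) = Complex.exp (lam * t) * Complex.exp (-lam * s) := by
      rw [← Complex.exp_add]; push_cast; ring_nf
    simp only [laplaceIntegrand, Complex.reCLM_apply, this]
    rw [← mul_assoc (Complex.exp _), Complex.re_mul_ofReal]
    ring
  rw [hint]
  have hlam : lam = a + b * laplaceTransform K lam := by
    rw [charFunction] at hroot
    linear_combination hroot
  have hsplit : Complex.exp (lam * t) * (lam * 1) = (a : ℂ) * Complex.exp (lam * t) +
      (b : ℂ) * (Complex.exp (lam * t) * laplaceTransform K lam) := by
    linear_combination Complex.exp (lam * t) * hlam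
  rw [hsplit, Complex.add_re, Complex.re_ofReal_mul, Complex.re_ofReal_mul]
  ring

/-- Along multiples of the period `2π / |Im λ|` the cosine equals `1`, so the values stay at least
`ε`; for real `λ` any step works. -/
theorem not_tendsto_re_exp {ε : ℝ} (hε : 0 < ε) {lam : ℂ} (hlam : 0 ≤ lam.re) :
    ¬ Tendsto (fun t : ℝ => ε * (Complex.exp (lam * t)).re) atTop (𝓝 0) := by
  intro h
  obtain ⟨p, hp, hcos⟩ : ∃ p : ℝ, 0 < p ∧ ∀ n : ℕ, Real.cos (lam.im * (n * p)) = 1 := by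
    by_cases him : lam.im = 0
    · exact ⟨1, one_pos, fun n => by simp [him]⟩
    · refine ⟨2 * Real.pi / |lam.im|, by positivity, fun n => ?_⟩
      rw [← Real.cos_abs, abs_mul, abs_of_nonneg (by positivity : 0 ≤ n * (2 * Real.pi / |lam.im|))]
      have : |lam.im| * (n * (2 * Real.pi / |lam.im|)) = n * (2 * Real.pi) := by
        field_simp
      rw [this, Real.cos_nat_mul_two_pi]
  have hseq : Tendsto (fun n : ℕ => (n : ℝ) * p) atTop atTop :=
    tendsto_natCast_atTop_atTop.atTop_mul_const hp
  have hge := ge_of_tendsto' (h.comp hseq) (b := ε) fun n => by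
    simp only [Function.comp_apply, Complex.exp_re, Complex.mul_re, Complex.mul_im,
      Complex.ofReal_re, Complex.ofReal_im, mul_zero, sub_zero, zero_add]
    rw [hcos n, mul_one]
    exact le_mul_of_one_le_right hε.le (Real.one_le_exp (by positivity))
  linarith

/-- For `Re λ ≥ 0` the exponential has modulus at most `1` on `(-∞, 0]`, so the multiple `δ / 2` is
an admissible initial function. -/
theorem alphaZero_neg_of_locallyAttractive {a b μ : ℝ} {K : ℝ → ℝ} (hμ : 0 < μ)
    (hKμ : IntegrableOn (laplaceIntegrand K (-μ : ℝ)) (Ioi 0))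
    (h : TrivialSolutionLocallyAttractive a b K) : alphaZero a b K < 0 := by
  by_contra! h0
  obtain ⟨lam, hre, hroot⟩ := exists_root_of_zero_le_alphaZero hμ hKμ h0
  obtain ⟨δ, hδ, hattr⟩ := h
  have hbd : ∀ θ : Iic (0 : ℝ), ‖δ / 2 * (Complex.exp (lam * (θ : ℝ))).re‖ ≤ δ / 2 := fun θ => by
    rw [norm_mul, Real.norm_of_nonneg (by positivity : 0 ≤ δ / 2)]
    refine mul_le_of_le_one_right (by positivity) ((Complex.abs_re_le_norm _).trans ?_)
    rw [Complex.norm_exp, Real.exp_le_one_iff, Complex.re_mul_ofReal]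
    exact mul_nonpos_of_nonneg_of_nonpos hre θ.2
  set φ : Iic (0 : ℝ) →ᵇ ℝ := BoundedContinuousFunction.ofNormedAddCommGroup
    (fun θ : Iic (0 : ℝ) => δ / 2 * (Complex.exp (lam * (θ : ℝ))).re) (by fun_prop) (δ / 2) hbd
  have hφ : ‖φ‖ < δ := lt_of_le_of_lt
    (BoundedContinuousFunction.norm_ofNormedAddCommGroup_le _ (by positivity) hbd) (by linarith)
  exact not_tendsto_re_exp (half_pos hδ) hre (hattr φ _ (isDelaySolution_exp
    (integrableOn_laplaceIntegrand hKμ (by linarith)) hroot fun _ => rfl) hφ)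

/-! ### Stability from the estimate, and the main theorem -/

theorem locallyAsymptoticallyStable_of_exponential_bound {a b α K₁ : ℝ} {K : ℝ → ℝ} (hα : α < 0)
    (hK₁ : 0 < K₁)
    (h : ∀ (φ : Iic (0 : ℝ) →ᵇ ℝ) (x : ℝ → ℝ), IsDelaySolution a b K φ x →
      ∀ t : ℝ, 0 ≤ t → |x t| ≤ K₁ * ‖φ‖ * Real.exp (α * t)) :
    TrivialSolutionLocallyAsymptoticallyStable a b K := by
  refine ⟨fun ε hε => ⟨ε / K₁, by positivity, fun φ x hx hφ t ht => ?_⟩,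
    1, one_pos, fun φ x hx _ => ?_⟩
  · calc |x t| ≤ K₁ * ‖φ‖ * Real.exp (α * t) := h φ x hx t ht
      _ ≤ K₁ * ‖φ‖ := mul_le_of_le_one_right (by positivity)
        (Real.exp_le_one_iff.2 (mul_nonpos_of_nonpos_of_nonneg hα.le ht))
      _ < ε := by rwa [lt_div_iff₀ hK₁, mul_comm] at hφ
  · have hlim : Tendsto (fun t : ℝ => K₁ * ‖φ‖ * Real.exp (α * t)) atTop (𝓝 0) := by
      have : Tendsto (fun t : ℝ => α * t) atTop atBot := tendsto_id.const_mul_atTop_of_neg hα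
      simpa using (Real.tendsto_exp_atBot.comp this).const_mul (K₁ * ‖φ‖)
    refine squeeze_zero_norm' ?_ hlim
    filter_upwards [eventually_ge_atTop 0] with t ht using h φ x hx t ht

theorem theorem2p4 (a b μ : ℝ) (K : ℝ → ℝ)
    (hK_nonneg : ∀ s : ℝ, 0 ≤ s → 0 ≤ K s)
    (hK_pc : PiecewiseContinuousOnHalfLine K)
    (hK_int : IntegrableOn K (Ioi (0 : ℝ)))
    (hK_one : ∫ s in Ioi (0 : ℝ), K s = 1)
    (hμ : 0 < μ)
    (hK_exp : IntegrableOn (fun s : ℝ => Real.exp (μ * s) * K s) (Ioi (0 : ℝ))) :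
    (∀ α : ℝ, max (alphaZero a b K) ((-μ : ℝ) : EReal) < (α : EReal) →
      ∃ K₁ : ℝ, 0 < K₁ ∧
        ∀ (φ : Iic (0 : ℝ) →ᵇ ℝ) (x : ℝ → ℝ), IsDelaySolution a b K φ x →
          ∀ t : ℝ, 0 ≤ t → |x t| ≤ K₁ * ‖φ‖ * Real.exp (α * t)) ∧
    (TrivialSolutionLocallyAsymptoticallyStable a b K ↔ alphaZero a b K < 0) := by
  have hKμ : IntegrableOn (laplaceIntegrand K (-μ : ℝ)) (Ioi 0) := by
    have h : IntegrableOn (fun s : ℝ => ((Real.exp (μ * s) * K s : ℝ) : ℂ)) (Ioi 0) := hK_exp.ofReal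
    refine h.congr_fun (fun s _ => ?_) measurableSet_Ioi
    simp only [laplaceIntegrand_real, neg_neg]
  have hbound : ∀ α : ℝ, max (alphaZero a b K) ((-μ : ℝ) : EReal) < (α : EReal) →
      ∃ K₁ : ℝ, 0 < K₁ ∧
        ∀ (φ : Iic (0 : ℝ) →ᵇ ℝ) (x : ℝ → ℝ), IsDelaySolution a b K φ x →
          ∀ t : ℝ, 0 ≤ t → |x t| ≤ K₁ * ‖φ‖ * Real.exp (α * t) := fun α hα => by
    obtain ⟨h1, h2⟩ := max_lt_iff.1 hα
    have h2' : -μ < α := EReal.coe_lt_coe_iff.1 h2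
    refine exists_exponential_bound hK_nonneg hK_int hK_one hμ hKμ h2' fun z hz hroot => ?_
    have h3 : ((z.re : ℝ) : EReal) < α := (re_le_alphaZero
      ⟨integrableOn_laplaceIntegrand hKμ (by linarith), hroot⟩).trans_lt h1
    exact absurd hz (not_le.2 (EReal.coe_lt_coe_iff.1 h3))
  refine ⟨hbound, fun h => alphaZero_neg_of_locallyAttractive hμ hKμ h.2, fun h => ?_⟩
  obtain ⟨α, h1, h2⟩ := EReal.lt_iff_exists_real_btwn.1
    (max_lt h (EReal.coe_lt_coe_iff.2 (neg_lt_zero.2 hμ)) :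
      max (alphaZero a b K) ((-μ : ℝ) : EReal) < ((0 : ℝ) : EReal))
  obtain ⟨K₁, hK₁, hK₁'⟩ := hbound α h1
  exact locallyAsymptoticallyStable_of_exponential_bound (EReal.coe_lt_coe_iff.1 h2) hK₁ hK₁'
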